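/- Let $v_0(m)$, $m\ge 0$, be the integers defined by $$\sum_{m=0}^\infty v_0(m)\,q^m=\sum_{n=0}^\infty \frac{q^{n^2}(-q;q^2)_n}{(q;q^2)_n},\qquad (a;q)_n=\prod_{i=1}^{n}(1-aq^{i-1}),$$ that is, the coefficients of $\frac{V_0(q)+1}{2}$, where $V_0(q)$ is the eighth order mock theta function of Gordon and McIntosh. Let $\alpha\ge 1$ be an integer, let $p\ge 3$ be a prime, and let $r\ge 0$ be an integer which is a quadratic nonresidue modulo $p$. Then for every integer $n\ge 0$, $$v_0\bigl(2^{2\alpha+2}(pn+r)\bigr)\equiv 0 \pmod{2^{3\alpha+2}}.$$ -/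

import Mathlib

open PowerSeries
open scoped PowerSeries.WithPiTopology

/-- The finite `q`-Pochhammer symbol `(a; q)_n = ∏_{i=1}^n (1 - a q^{i-1})`. -/
def qPoch {R : Type*} [CommRing R] (a q : R) (n : ℕ) : R :=
  ∏ i ∈ Finset.range n, (1 - a * q ^ i)

/-- The `n`-th summand `q^{n^2} (-q; q^2)_n / (q; q^2)_n`, as a formal power series in `q = X` with
integer coefficients. The denominator has constant coefficient `1`, so it is inverted with
`invOfUnit _ 1`. -/
noncomputable def v0Term (n : ℕ) : PowerSeries ℤ :=
  X ^ (n ^ 2) * qPoch (-X) (X ^ 2) n * invOfUnit (qPoch X (X ^ 2) n) 1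

/-- The coefficient `v_0(m)` of `q^m` in `∑_{n ≥ 0} q^{n^2} (-q; q^2)_n / (q; q^2)_n`.
The summand of index `n` is divisible by `q^{n^2}`, so only those with `n ≤ m` contribute. -/
noncomputable def v0 (m : ℕ) : ℤ :=
  ∑ n ∈ Finset.range (m + 1), coeff m (v0Term n)

/-- `invOfUnit` is a true inverse in `v0Term`. -/
theorem v0Term_mul_denominator (n : ℕ) :
    v0Term n * qPoch X (X ^ 2) n = X ^ (n ^ 2) * qPoch (-X) (X ^ 2) n := by
  have h : constantCoeff (qPoch (X : PowerSeries ℤ) (X ^ 2) n) = ((1 : ℤˣ) : ℤ) := by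
    simp [qPoch, map_prod]
  rw [v0Term, mul_assoc, mul_comm (invOfUnit _ _), mul_invOfUnit _ _ h, mul_one]

/-- The power series `∑ v_0(m) q^m` is the sum of the infinite series
`∑_{n ≥ 0} q^{n^2} (-q; q^2)_n / (q; q^2)_n`, in the topology of coefficientwise convergence. -/
theorem hasSum_v0Term : HasSum v0Term (PowerSeries.mk v0) := by
  rw [PowerSeries.WithPiTopology.hasSum_iff_hasSum_coeff]
  intro m
  rw [coeff_mk, v0]
  apply hasSum_sum_of_ne_finset_zero
  intro n hn
  have hlt : m < n ^ 2 := by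
    have : m < n := by simpa using hn
    nlinarith
  rw [v0Term, mul_assoc, coeff_X_pow_mul', if_neg (by omega)]

/-! ### Summability of families of power series -/

/-! Write φ(q) = ∑ q^(n²), V(q) = ∑ v_0(m) q^m, and let U be `dissect 4`. The proof shows that the
series ∑ v_0(4m) q^m is a theta quotient up to its constant term, and then iterates U on that
quotient.

The sum of q^(n²) (-q;q²)_n / (q;q²)_n over all integers n is V(q) + V(-q) - 1. Multiplied by an
infinite product, each term is a product of two Euler series; expanding these and summing in another
order (`bilateral_sum`) gives V(q) + V(-q) - 1 = φ(q²)² / φ(-q⁴) (`v0_even_part_mul_theta`).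
Applying U gives φ(q)² / φ(-q), with coefficients 2 v_0(4m) for m > 0.

Split φ(q) = A + B into even and odd exponents. Since A⁴ - B⁴ = φ(-q⁴)⁴ is a series in q⁴, 1/φ(-q)
is a polynomial in A and B times a series in q⁴, and U keeps A^i B^l only when 4 ∣ l. With h =
`hauptmodul`, this gives U(φ²/φ(-q)) = φ + 32 φh, Uφ = φ, and U(φ h^k) in 8 times the span of the φ
h^j, j ≥ 1. Each further U thus contributes a factor 8 to the error term, while φ has no coefficient
at a nonsquare; pn + r is never a square. Finally 2 ∣ h cancels the 2 in 2 v_0(4m). -/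

theorem summable_of_X_pow_dvd {ι : Type*} {f : ι → ℤ⟦X⟧} (w : ι → ℕ)
    (h : ∀ i, (X : ℤ⟦X⟧) ^ w i ∣ f i) (hw : ∀ d, {i | w i ≤ d}.Finite) : Summable f := by
  rw [PowerSeries.WithPiTopology.summable_iff_summable_coeff]
  intro d
  apply summable_of_ne_finset_zero (s := (hw d).toFinset)
  intro i hi
  have hlt : d < w i := by simpa using hi
  exact (X_pow_dvd_iff.mp (h i)) d hlt

theorem finite_setOf_sq_le (d : ℕ) : {n : ℤ | (n ^ 2).toNat ≤ d}.Finite := by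
  apply (Set.finite_Icc (-(d : ℤ)) d).subset
  intro n hn
  have h1 : n ^ 2 ≤ d := by
    have : (n ^ 2).toNat ≤ d := hn
    omega
  constructor <;> nlinarith [sq_nonneg n]

/-- Powers with an integer exponent, which is meant to be nonnegative. -/
noncomputable def qpow (Q : ℤ⟦X⟧) (n : ℤ) : ℤ⟦X⟧ := Q ^ n.toNat

theorem qpow_mul_qpow (Q : ℤ⟦X⟧) {a b : ℤ} (ha : 0 ≤ a) (hb : 0 ≤ b) :
    qpow Q a * qpow Q b = qpow Q (a + b) := by
  rw [qpow, qpow, qpow, ← pow_add, Int.toNat_add ha hb]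

theorem mul_qpow (Q : ℤ⟦X⟧) {a : ℤ} (ha : 0 ≤ a) : Q * qpow Q a = qpow Q (1 + a) := by
  rw [← qpow_mul_qpow Q zero_le_one ha]
  simp [qpow]

theorem qpow_natCast (Q : ℤ⟦X⟧) (n : ℕ) : qpow Q n = Q ^ n := by simp [qpow]

theorem qpow_zero (Q : ℤ⟦X⟧) : qpow Q 0 = 1 := by simp [qpow]

theorem X_pow_dvd_qpow {Q : ℤ⟦X⟧} (hQ : X ∣ Q) (n : ℤ) : X ^ n.toNat ∣ qpow Q n :=
  pow_dvd_pow_of_dvd hQ _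

/-- Negative `n` is harmless: both exponents are truncated to 0. -/
theorem qpow_pow (Q : ℤ⟦X⟧) (k : ℕ) (n : ℤ) : qpow (Q ^ k) n = qpow Q (k * n) := by
  rw [qpow, qpow, ← pow_mul]
  rcases le_or_gt 0 n with h | h
  · lift n to ℕ using h
    norm_cast
  · rw [Int.toNat_of_nonpos h.le, Int.toNat_of_nonpos (by nlinarith)]
    simp

/-! ### Theta series -/

/-- `φ(Q) = ∑ Q ^ (n ^ 2)`, over all integers `n`. -/
noncomputable def theta (Q : ℤ⟦X⟧) : ℤ⟦X⟧ := ∑' n : ℤ, qpow Q (n ^ 2)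

/-- `∑ Q ^ (n (n + 1))`, over all integers `n`. -/
noncomputable def thetaTri (Q : ℤ⟦X⟧) : ℤ⟦X⟧ := ∑' n : ℤ, qpow Q (n * (n + 1))

theorem summable_theta {Q : ℤ⟦X⟧} (hQ : X ∣ Q) : Summable fun n : ℤ => qpow Q (n ^ 2) :=
  summable_of_X_pow_dvd _ (fun _ => X_pow_dvd_qpow hQ _) finite_setOf_sq_le

theorem finite_setOf_tri_le (d : ℕ) : {n : ℤ | (n * (n + 1)).toNat ≤ d}.Finite := by
  apply (Set.finite_Icc (-(d : ℤ) - 1) d).subset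
  intro n hn
  have h1 : n * (n + 1) ≤ d := by
    have : (n * (n + 1)).toNat ≤ d := hn
    omega
  constructor
  · by_contra hc
    nlinarith
  · by_contra hc
    nlinarith

theorem summable_thetaTri {Q : ℤ⟦X⟧} (hQ : X ∣ Q) :
    Summable fun n : ℤ => qpow Q (n * (n + 1)) :=
  summable_of_X_pow_dvd _ (fun _ => X_pow_dvd_qpow hQ _) finite_setOf_tri_le

theorem mul_add_one_nonneg (n : ℤ) : 0 ≤ n * (n + 1) := by
  rcases le_or_gt 0 n with h | h
  · positivity
  · nlinarith

theorem tsum_eq_tsum_add_tsum {ι κ : Type*} {f : ι → ℤ⟦X⟧} (hf : Summable f) {g h : κ → ι}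
    (hg : Function.Injective g) (hh : Function.Injective h)
    (hd : ∀ a b, g a ≠ h b) (hu : ∀ i, (∃ a, g a = i) ∨ ∃ b, h b = i) :
    ∑' i, f i = ∑' k, f (g k) + ∑' k, f (h k) :=
  (HasSum.add_isCompl
    ⟨Set.disjoint_left.mpr (by rintro _ ⟨a, rfl⟩ ⟨b, hb⟩; exact hd a b hb.symm),
      codisjoint_iff_le_sup.mpr fun i _ => hu i⟩
    (hg.hasSum_range_iff.mpr (hf.comp_injective hg).hasSum)
    (hh.hasSum_range_iff.mpr (hf.comp_injective hh).hasSum)).tsum_eq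

theorem qpow_mul_base (P Q : ℤ⟦X⟧) (n : ℤ) : qpow (P * Q) n = qpow P n * qpow Q n :=
  mul_pow _ _ _

theorem qpow_two_mul_of_sq_eq_one {P : ℤ⟦X⟧} (hP : P ^ 2 = 1) (n : ℤ) : qpow P (2 * n) = 1 := by
  have h := qpow_pow P 2 n
  rw [hP] at h
  rw [Nat.cast_ofNat] at h
  rw [← h, qpow, one_pow]

theorem theta_eq_add {Q : ℤ⟦X⟧} (hQ : X ∣ Q) :
    theta Q = theta (Q ^ 4) + Q * thetaTri (Q ^ 4) := by
  have hQ4 : X ∣ Q ^ 4 := dvd_pow hQ (by norm_num)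
  rw [theta, tsum_eq_tsum_add_tsum (summable_theta hQ) (g := fun n => 2 * n)
    (h := fun n => 2 * n + 1) (fun a b h => by simpa using h) (fun a b h => by simpa using h)
    (fun a b h => by omega)
    (fun n => (Int.even_or_odd' n).elim fun k hk => hk.imp (fun h => ⟨k, h.symm⟩)
      (fun h => ⟨k, h.symm⟩)), theta, thetaTri, ← (summable_thetaTri hQ4).tsum_mul_left]
  · congr 1
    · refine tsum_congr fun n => ?_
      rw [qpow_pow]
      congr 1
      push_cast
      ring
    · refine tsum_congr fun n => ?_
      have h2 := mul_add_one_nonneg n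
      rw [qpow_pow, mul_qpow _ (by push_cast; positivity)]
      congr 1
      push_cast
      ring

theorem theta_neg {Q : ℤ⟦X⟧} (hQ : X ∣ Q) :
    theta (-Q) = theta (Q ^ 4) - Q * thetaTri (Q ^ 4) := by
  rw [theta_eq_add (dvd_neg.mpr hQ), Even.neg_pow (by decide)]
  ring

theorem finite_setOf_add_le {ι κ : Type*} {v : ι → ℕ} {w : κ → ℕ}
    (hv : ∀ d, {i | v i ≤ d}.Finite) (hw : ∀ d, {i | w i ≤ d}.Finite) (d : ℕ) :
    {p : ι × κ | v p.1 + w p.2 ≤ d}.Finite := by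
  apply ((hv d).prod (hw d)).subset
  rintro ⟨i, k⟩ h
  have h' : v i + w k ≤ d := h
  exact ⟨show v i ≤ d by omega, show w k ≤ d by omega⟩

theorem tsum_mul_tsum_of_X_pow_dvd {ι κ : Type*} {f : ι → ℤ⟦X⟧} {g : κ → ℤ⟦X⟧}
    (v : ι → ℕ) (w : κ → ℕ) (hf : ∀ i, (X : ℤ⟦X⟧) ^ v i ∣ f i) (hg : ∀ k, (X : ℤ⟦X⟧) ^ w k ∣ g k)
    (hv : ∀ d, {i | v i ≤ d}.Finite) (hw : ∀ d, {i | w i ≤ d}.Finite) :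
    HasSum (fun p : ι × κ => f p.1 * g p.2) ((∑' i, f i) * ∑' k, g k) := by
  have hs : Summable fun p : ι × κ => f p.1 * g p.2 := by
    refine summable_of_X_pow_dvd (fun p => v p.1 + w p.2) (fun p => ?_) (finite_setOf_add_le hv hw)
    rw [pow_add]
    exact mul_dvd_mul (hf _) (hg _)
  rw [(summable_of_X_pow_dvd v hf hv).tsum_mul_tsum (summable_of_X_pow_dvd w hg hw) hs]
  exact hs.hasSum

/-- Both quadratic relations between `φ(Q ^ 4)` and the odd part of `φ(Q)`. -/
theorem theta_sq_add {Q P : ℤ⟦X⟧} (hQ : X ∣ Q) (hP : P ^ 2 = 1) :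
    theta (Q ^ 4) ^ 2 + P * (Q * thetaTri (Q ^ 4)) ^ 2 = theta (P * Q ^ 2) ^ 2 := by
  have hQ4 : X ∣ Q ^ 4 := dvd_pow hQ (by norm_num)
  have hQ2 : X ∣ P * Q ^ 2 := (dvd_pow hQ (by norm_num)).mul_left _
  have h0 := tsum_mul_tsum_of_X_pow_dvd _ _ (fun n : ℤ => X_pow_dvd_qpow hQ2 (n ^ 2))
    (fun n : ℤ => X_pow_dvd_qpow hQ2 (n ^ 2)) finite_setOf_sq_le finite_setOf_sq_le
  have h1 := tsum_mul_tsum_of_X_pow_dvd _ _ (fun n : ℤ => X_pow_dvd_qpow hQ4 (n ^ 2))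
    (fun n : ℤ => X_pow_dvd_qpow hQ4 (n ^ 2)) finite_setOf_sq_le finite_setOf_sq_le
  have h2 := tsum_mul_tsum_of_X_pow_dvd _ _ (fun n : ℤ => X_pow_dvd_qpow hQ4 (n * (n + 1)))
    (fun n : ℤ => X_pow_dvd_qpow hQ4 (n * (n + 1))) finite_setOf_tri_le finite_setOf_tri_le
  have key : ∀ n : ℤ, qpow (P * Q ^ 2) n = qpow P n * qpow Q (2 * n) := fun n => by
    rw [qpow_mul_base, qpow_pow, Nat.cast_ofNat]
  -- The lattice of pairs (u, v) is split by the parity of u + v. Equal parity gives u² + v² = 2(a²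
  -- + b²), where `P` disappears; opposite parity gives an odd exponent, which leaves one factor
  -- `P`.
  rw [sq (theta (P * Q ^ 2)), ← show _ = theta (P * Q ^ 2) * theta (P * Q ^ 2) from h0.tsum_eq,
    tsum_eq_tsum_add_tsum h0.summable (g := fun p : ℤ × ℤ => (p.1 + p.2, p.1 - p.2))
      (h := fun p : ℤ × ℤ => (p.1 + p.2 + 1, p.1 - p.2)) ?_ ?_ ?_ ?_]
  · congr 1
    · rw [sq, ← show _ = theta (Q ^ 4) * theta (Q ^ 4) from h1.tsum_eq]
      refine tsum_congr fun p => ?_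
      rw [qpow_mul_qpow _ (sq_nonneg _) (sq_nonneg _), qpow_mul_qpow _ (sq_nonneg _) (sq_nonneg _),
        key, show (p.1 + p.2) ^ 2 + (p.1 - p.2) ^ 2 = 2 * (p.1 ^ 2 + p.2 ^ 2) by ring,
        qpow_two_mul_of_sq_eq_one hP, one_mul, qpow_pow]
      congr 1
      push_cast
      ring
    · rw [mul_pow, sq (thetaTri _), ← show _ = thetaTri (Q ^ 4) * thetaTri (Q ^ 4) from h2.tsum_eq, ← mul_assoc,
        ← h2.summable.tsum_mul_left]
      refine tsum_congr fun p => ?_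
      have n1 := mul_add_one_nonneg p.1
      have n2 := mul_add_one_nonneg p.2
      have e1 : P = qpow P 1 := by simp [qpow]
      have e2 : Q ^ 2 = qpow Q 2 := by simp [qpow]
      rw [qpow_mul_qpow _ (sq_nonneg _) (sq_nonneg _), qpow_mul_qpow _ n1 n2,
        key, show (p.1 + p.2 + 1) ^ 2 + (p.1 - p.2) ^ 2
          = 1 + 2 * (p.1 * (p.1 + 1) + p.2 * (p.2 + 1)) by ring,
        ← qpow_mul_qpow P (by norm_num) (by positivity),
        qpow_two_mul_of_sq_eq_one hP, mul_one, ← e1, mul_assoc, qpow_pow, e2,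
        qpow_mul_qpow Q (by norm_num) (by push_cast; positivity)]
      congr 2
      push_cast
      ring
  · rintro ⟨a, b⟩ ⟨c, d⟩ h
    simp only [Prod.mk.injEq] at h ⊢
    omega
  · rintro ⟨a, b⟩ ⟨c, d⟩ h
    simp only [Prod.mk.injEq] at h ⊢
    omega
  · rintro ⟨a, b⟩ ⟨c, d⟩ h
    simp only [Prod.mk.injEq] at h
    omega
  · rintro ⟨u, v⟩
    rcases Int.even_or_odd' (u + v) with ⟨k, hk | hk⟩
    · refine Or.inl ⟨(k, u - k), ?_⟩
      simp only [Prod.mk.injEq]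
      omega
    · refine Or.inr ⟨(k, u - k - 1), ?_⟩
      simp only [Prod.mk.injEq]
      omega

/-- The involution n ↦ -1 - n preserves n(n + 1) and has no fixed point. -/
theorem two_dvd_thetaTri {Q : ℤ⟦X⟧} (hQ : X ∣ Q) : 2 ∣ thetaTri Q := by
  have hg : Function.Injective fun n : ℕ => (n : ℤ) := Nat.cast_injective
  have hh : Function.Injective fun n : ℕ => -1 - (n : ℤ) := fun a b h => by
    dsimp only at h; omega
  rw [thetaTri, tsum_eq_tsum_add_tsum (summable_thetaTri hQ) hg hh
    (fun a b h => by omega) (fun i => ?_)]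
  · refine ⟨∑' n : ℕ, qpow Q (n * (n + 1)), ?_⟩
    rw [two_mul]
    congr 1
    refine tsum_congr fun n => ?_
    congr 1
    ring
  · rcases le_or_gt 0 i with h | h
    · exact Or.inl ⟨i.toNat, by omega⟩
    · exact Or.inr ⟨(-1 - i).toNat, by omega⟩

theorem theta_mul_theta_neg {Q : ℤ⟦X⟧} (hQ : X ∣ Q) :
    theta Q * theta (-Q) = theta (-Q ^ 2) ^ 2 := by
  have h := theta_sq_add hQ (P := -1) (by norm_num)
  rw [neg_one_mul (Q ^ 2)] at h
  rw [theta_neg hQ, theta_eq_add hQ, ← h]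
  ring

/-! ### Dissections -/

/-- The operator that keeps the coefficients whose index is a multiple of `p`. -/
noncomputable def dissect (p : ℕ) : ℤ⟦X⟧ →ₗ[ℤ] ℤ⟦X⟧ where
  toFun f := PowerSeries.mk fun n => coeff (p * n) f
  map_add' f g := by ext n; simp
  map_smul' a f := by
    ext n
    rw [RingHom.id_apply, coeff_mk, map_zsmul, map_zsmul, coeff_mk]

theorem coeff_dissect (p n : ℕ) (f : ℤ⟦X⟧) : coeff n (dissect p f) = coeff (p * n) f := by
  simp [dissect]

theorem dissect_expand (p : ℕ) (hp : p ≠ 0) (f : ℤ⟦X⟧) : dissect p (expand p hp f) = f := by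
  ext n
  rw [coeff_dissect, coeff_expand_mul]

theorem dissect_expand_mul_X_pow (p : ℕ) (hp : p ≠ 0) (f : ℤ⟦X⟧) (j : ℕ) :
    dissect p (expand p hp f * X ^ (p * j)) = f * X ^ j := by
  rw [pow_mul, ← expand_X p hp, ← map_pow, ← map_mul, dissect_expand]

theorem dissect_expand_mul_X_pow_of_not_dvd (p : ℕ) (hp : p ≠ 0) (f : ℤ⟦X⟧) {l : ℕ}
    (hl : ¬ p ∣ l) : dissect p (expand p hp f * X ^ l) = 0 := by
  ext n
  rw [coeff_dissect, coeff_mul_X_pow', map_zero]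
  split_ifs with h
  · apply coeff_expand_of_not_dvd
    intro hd
    exact hl ((Nat.dvd_sub_iff_right h (dvd_mul_right p n)).mp hd)
  · rfl

theorem HasSum.expand {ι : Type*} {f : ι → ℤ⟦X⟧} {a : ℤ⟦X⟧} (h : HasSum f a) (p : ℕ)
    (hp : p ≠ 0) : HasSum (fun i => PowerSeries.expand p hp (f i)) (PowerSeries.expand p hp a) := by
  rw [PowerSeries.WithPiTopology.hasSum_iff_hasSum_coeff] at h ⊢
  intro d
  simp only [coeff_expand]
  split_ifs with hd
  · exact h _
  · exact hasSum_zero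

theorem expand_theta (p : ℕ) (hp : p ≠ 0) {Q : ℤ⟦X⟧} (hQ : X ∣ Q) :
    expand p hp (theta Q) = theta (expand p hp Q) := by
  rw [theta, ← ((summable_theta hQ).hasSum.expand p hp).tsum_eq]
  exact tsum_congr fun n => map_pow _ _ _

theorem expand_thetaTri (p : ℕ) (hp : p ≠ 0) {Q : ℤ⟦X⟧} (hQ : X ∣ Q) :
    expand p hp (thetaTri Q) = thetaTri (expand p hp Q) := by
  rw [thetaTri, ← ((summable_thetaTri hQ).hasSum.expand p hp).tsum_eq]
  exact tsum_congr fun n => map_pow _ _ _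

theorem constantCoeff_theta {Q : ℤ⟦X⟧} (hQ : X ∣ Q) : constantCoeff (theta Q) = 1 := by
  have h := (PowerSeries.WithPiTopology.hasSum_iff_hasSum_coeff (R := ℤ)).mp (summable_theta hQ).hasSum 0
  have h1 : HasSum (fun n : ℤ => coeff 0 (qpow Q (n ^ 2))) 1 := by
    convert hasSum_ite_eq (0 : ℤ) (1 : ℤ) using 2 with n
    have hc : constantCoeff Q = 0 := X_dvd_iff.mp hQ
    rw [coeff_zero_eq_constantCoeff, qpow, map_pow, hc]
    split_ifs with h0
    · simp [h0]
    · rw [zero_pow]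
      have : 0 < n ^ 2 := by positivity
      omega
  rw [← coeff_zero_eq_constantCoeff]
  exact h.unique h1

theorem coeff_theta_X_of_not_isSquare {m : ℕ} (hm : ¬ IsSquare m) : coeff m (theta X) = 0 := by
  have h := (PowerSeries.WithPiTopology.hasSum_iff_hasSum_coeff (R := ℤ)).mp
    (summable_theta (dvd_refl X)).hasSum m
  refine h.unique ?_
  convert hasSum_zero with n
  rw [qpow, coeff_X_pow, if_neg]
  intro hn
  apply hm
  refine ⟨n.natAbs, ?_⟩
  zify
  rw [hn, Int.toNat_of_nonneg (sq_nonneg n), abs_mul_abs_self, sq]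

/-! ### The even and odd parts of φ(q) and Jacobi's quartic identity -/

theorem exists_theta_neg_mul_eq_one : ∃ c : ℤ⟦X⟧, theta (-X) * c = 1 :=
  ⟨invOfUnit (theta (-X)) 1, mul_invOfUnit _ _ (by
    rw [constantCoeff_theta (dvd_neg.mpr dvd_rfl), Units.val_one])⟩

/-- The part of `φ(q)` with exponents divisible by `4`. -/
noncomputable def thetaEven : ℤ⟦X⟧ := expand 4 (by norm_num) (theta X)

/-- The part of `φ(q)` with odd exponents. -/
noncomputable def thetaOdd : ℤ⟦X⟧ := X * expand 4 (by norm_num) (thetaTri X)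

theorem thetaEven_eq : thetaEven = theta (X ^ 4) := by
  rw [thetaEven, expand_theta 4 _ dvd_rfl, expand_X]

theorem thetaOdd_eq : thetaOdd = X * thetaTri (X ^ 4) := by
  rw [thetaOdd, expand_thetaTri 4 _ dvd_rfl, expand_X]

theorem theta_X_eq :
    theta X = thetaEven + thetaOdd := by
  rw [thetaEven_eq, thetaOdd_eq, theta_eq_add dvd_rfl]

theorem theta_neg_X_eq :
    theta (-X) = thetaEven - thetaOdd := by
  rw [thetaEven_eq, thetaOdd_eq, theta_neg dvd_rfl]

/-- With A and B the two parts of φ, A² + B² = φ(q²)² and A² - B² = φ(-q²)², while φ(q²) φ(-q²) =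
φ(-q⁴)². -/
theorem expand_theta_pow_four_sub :
    thetaEven ^ 4 - thetaOdd ^ 4
      = (expand 4 (by norm_num) (theta (-X))) ^ 4 := by
  have h1 := theta_sq_add (Q := X) dvd_rfl (P := 1) (by norm_num)
  have h2 := theta_sq_add (Q := X) dvd_rfl (P := -1) (by norm_num)
  have h3 := theta_mul_theta_neg (Q := X ^ 2) (dvd_pow_self _ two_ne_zero)
  rw [thetaEven_eq, thetaOdd_eq, expand_theta 4 _ (dvd_neg.mpr dvd_rfl), map_neg, expand_X]
  rw [one_mul] at h1
  rw [neg_one_mul (X ^ 2)] at h2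
  rw [← pow_mul] at h3
  norm_num at h1 h2 h3
  linear_combination (exp := 1) theta (-X ^ 2) ^ 2 * h1 +
    (theta (X ^ 4) ^ 2 + (X * thetaTri (X ^ 4)) ^ 2) * h2 +
    (theta (X ^ 2) * theta (-X ^ 2) + theta (-X ^ 4) ^ 2) * h3

/-- Jacobi's identity; the previous identity involves only series in q⁴, so q⁴ may be replaced by q.
-/
theorem theta_pow_four_sub : theta X ^ 4 - X * thetaTri X ^ 4 = theta (-X) ^ 4 := by
  have h := congrArg (dissect 4) expand_theta_pow_four_sub
  rwa [thetaEven, thetaOdd, mul_pow, ← expand_X 4 (by norm_num), ← map_pow, ← map_pow, ← map_pow, ← map_mul, ← map_sub,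
    dissect_expand, dissect_expand] at h

/-- `(φ(q) ^ 4 / φ(-q) ^ 4 - 1) / 8`, where `c` stands for `1 / φ(-q)`. -/
noncomputable def hauptmodul (c : ℤ⟦X⟧) : ℤ⟦X⟧ :=
  c ^ 4 * (thetaEven * thetaOdd *
    (thetaEven ^ 2 + thetaOdd ^ 2))

/-- This rests on (A + B)⁴ - (A - B)⁴ = 8AB(A² + B²). -/
theorem theta_pow_four_mul {c : ℤ⟦X⟧} (hc : theta (-X) * c = 1) :
    theta X ^ 4 * c ^ 4 = 1 + 8 * hauptmodul c := by
  have h : (theta (-X) * c) ^ 4 = 1 := by rw [hc, one_pow]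
  rw [hauptmodul, theta_X_eq]
  rw [theta_neg_X_eq] at h
  linear_combination h

theorem X_mul_thetaTri_pow_four_mul {c : ℤ⟦X⟧} (hc : theta (-X) * c = 1) :
    X * thetaTri X ^ 4 * c ^ 4 = 8 * hauptmodul c := by
  have h : (theta (-X) * c) ^ 4 = 1 := by rw [hc, one_pow]
  linear_combination theta_pow_four_mul hc - c ^ 4 * theta_pow_four_sub - h

theorem two_dvd_hauptmodul (c : ℤ⟦X⟧) : 2 ∣ hauptmodul c := by
  obtain ⟨g, hg⟩ := two_dvd_thetaTri (Q := X) dvd_rfl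
  have h : thetaOdd = 2 * (X * expand 4 (by norm_num) g) := by
    rw [thetaOdd, hg, map_mul, map_ofNat]
    ring
  rw [hauptmodul]
  exact (((h ▸ dvd_mul_right _ _ : (2 : ℤ⟦X⟧) ∣ thetaOdd).mul_left _).mul_right _).mul_left _

/-- This is 1/(A - B) = (A + B)(A² + B²)/(A⁴ - B⁴), whose denominator is a series in q⁴ and so
passes through `dissect 4`. -/
theorem inv_theta_neg_eq {c : ℤ⟦X⟧} (hc : theta (-X) * c = 1) :
    c = (thetaEven + thetaOdd) *
      (thetaEven ^ 2 + thetaOdd ^ 2) *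
      expand 4 (by norm_num) (c ^ 4) := by
  have h1 := expand_theta_pow_four_sub
  have h2 : (expand 4 (by norm_num) (theta (-X))) ^ 4 * expand 4 (by norm_num) (c ^ 4) = 1 := by
    rw [← map_pow, ← map_mul, ← mul_pow, hc, one_pow, map_one]
  rw [theta_neg_X_eq] at hc
  generalize expand 4 (by norm_num) (theta (-X)) = d at *
  generalize expand 4 (by norm_num) (c ^ 4) = e at *
  rw [← h1] at h2
  linear_combination (-c) * h2 +
    (thetaEven + thetaOdd) *
      (thetaEven ^ 2 + thetaOdd ^ 2) * e * hc

/-! ### The action of `dissect 4` on polynomials in the two parts of φ -/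

theorem dissect_four_theta : dissect 4 (theta X) = theta X := by
  have h := dissect_expand_mul_X_pow_of_not_dvd 4 (by norm_num) (thetaTri X) (l := 1) (by norm_num)
  rw [pow_one, mul_comm] at h
  conv_lhs => rw [theta_X_eq, map_add, thetaEven, thetaOdd, dissect_expand, h, add_zero]

theorem dissect_four_monomial (d : ℤ⟦X⟧) (i l : ℕ) (hl : ¬ 4 ∣ l) :
    dissect 4 (expand 4 (by norm_num) d * (thetaEven ^ i *
      thetaOdd ^ l)) = 0 := by
  rw [← dissect_expand_mul_X_pow_of_not_dvd 4 (by norm_num) (d * theta X ^ i * thetaTri X ^ l) hl]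
  congr 1
  simp only [thetaEven, thetaOdd, map_mul, map_pow]
  ring

theorem dissect_four_monomial_of_dvd (d : ℤ⟦X⟧) (i j : ℕ) :
    dissect 4 (expand 4 (by norm_num) d * (thetaEven ^ i *
      thetaOdd ^ (4 * j))) =
      d * theta X ^ i * (X * thetaTri X ^ 4) ^ j := by
  have h := dissect_expand_mul_X_pow 4 (by norm_num) (d * theta X ^ i * thetaTri X ^ (4 * j)) j
  rw [show d * theta X ^ i * (X * thetaTri X ^ 4) ^ j
    = d * theta X ^ i * thetaTri X ^ (4 * j) * X ^ j by ring, ← h]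
  congr 1
  simp only [thetaEven, thetaOdd, map_mul, map_pow]
  ring

theorem dissect_four_theta_sq_mul {c : ℤ⟦X⟧} (hc : theta (-X) * c = 1) :
    dissect 4 (theta X ^ 2 * c) = theta X + 32 * (theta X * hauptmodul c) := by
  have h5 := dissect_four_monomial_of_dvd (c ^ 4) 5 0
  have h4 := dissect_four_monomial (c ^ 4) 4 1 (by norm_num)
  have h3 := dissect_four_monomial (c ^ 4) 3 2 (by norm_num)
  have h2 := dissect_four_monomial (c ^ 4) 2 3 (by norm_num)
  have h1 := dissect_four_monomial_of_dvd (c ^ 4) 1 1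
  have h0 := dissect_four_monomial (c ^ 4) 0 5 (by norm_num)
  have e1 := theta_pow_four_mul hc
  have e2 := X_mul_thetaTri_pow_four_mul hc
  -- The coefficients 1, 3, 4, 4, 3, 1 are those of (A + B)³(A² + B²). Only A⁵ and 3AB⁴ survive,
  -- giving φ(1 + 8h) + 3φ · 8h.
  have key : theta X ^ 2 * c =
      expand 4 (by norm_num) (c ^ 4) * (thetaEven ^ 5 *
        thetaOdd ^ (4 * 0)) +
      (3 : ℤ) • (expand 4 (by norm_num) (c ^ 4) * (thetaEven ^ 4 *
        thetaOdd ^ 1)) +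
      (4 : ℤ) • (expand 4 (by norm_num) (c ^ 4) * (thetaEven ^ 3 *
        thetaOdd ^ 2)) +
      (4 : ℤ) • (expand 4 (by norm_num) (c ^ 4) * (thetaEven ^ 2 *
        thetaOdd ^ 3)) +
      (3 : ℤ) • (expand 4 (by norm_num) (c ^ 4) * (thetaEven ^ 1 *
        thetaOdd ^ (4 * 1))) +
      (expand 4 (by norm_num) (c ^ 4) * (thetaEven ^ 0 *
        thetaOdd ^ 5)) := by
    have hi := inv_theta_neg_eq hc
    have hi' : theta X ^ 2 * c = theta X ^ 2 * _ := congrArg _ hi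
    rw [hi', theta_X_eq]
    simp only [zsmul_eq_mul]
    push_cast
    ring
  rw [key]
  simp only [map_add, map_smul, h0, h1, h2, h3, h4, h5]
  simp only [zsmul_eq_mul]
  push_cast
  linear_combination theta X * e1 + 3 * theta X * e2

/-- The span of the series `φ(q) t ^ (k + 1)`. -/
noncomputable def thetaSpan (t : ℤ⟦X⟧) : Submodule ℤ ℤ⟦X⟧ :=
  Submodule.span ℤ (Set.range fun k : ℕ => theta X * t ^ (k + 1))

theorem theta_mul_aeval_mem (t : ℤ⟦X⟧) (P : Polynomial ℤ) :
    theta X * t * Polynomial.aeval t P ∈ thetaSpan t := by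
  rw [Polynomial.aeval_eq_sum_range, Finset.mul_sum]
  refine Submodule.sum_mem _ fun i _ => ?_
  rw [mul_smul_comm]
  refine Submodule.smul_mem _ _ (Submodule.subset_span ⟨i, ?_⟩)
  dsimp only
  ring

/-- A surviving monomial has l = 4(j + 1) because l ≥ 1, so at least one factor 8h appears. The
degree 16k + 1 matches the power of `c`, up to one remaining φ. -/
theorem dissect_four_monomial_mem {c : ℤ⟦X⟧} (hc : theta (-X) * c = 1) (k i l : ℕ)
    (hl : 1 ≤ l) (hil : i + l = 16 * k + 1) :
    dissect 4 (expand 4 (by norm_num) (c ^ (16 * k)) * (thetaEven ^ i * thetaOdd ^ l)) ∈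
      (thetaSpan (hauptmodul c)).map (LinearMap.mulLeft ℤ 8) := by
  by_cases h4 : 4 ∣ l
  · obtain ⟨j, rfl⟩ := h4
    obtain ⟨j, rfl⟩ : ∃ j', j = j' + 1 := ⟨j - 1, by omega⟩
    obtain ⟨m, rfl⟩ : ∃ m, i = 4 * m + 1 := ⟨i / 4, by omega⟩
    rw [dissect_four_monomial_of_dvd]
    refine ⟨_, theta_mul_aeval_mem (hauptmodul c)
      ((1 + 8 * Polynomial.X) ^ m * (8 * Polynomial.X) ^ j), ?_⟩
    have e1 := theta_pow_four_mul hc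
    have e2 := X_mul_thetaTri_pow_four_mul hc
    rw [LinearMap.mulLeft_apply]
    simp only [map_mul, map_pow, map_add, map_one, map_ofNat, Polynomial.aeval_X]
    rw [← e1, ← e2, show 16 * k = 4 * m + 4 * (j + 1) by omega]
    have e3 : (8 : ℤ⟦X⟧) * hauptmodul c * (X * thetaTri X ^ 4 * c ^ 4) ^ j
      = (X * thetaTri X ^ 4 * c ^ 4) ^ (j + 1) := by rw [← e2]; ring
    linear_combination (theta X * (theta X ^ 4 * c ^ 4) ^ m) * e3
  · rw [dissect_four_monomial _ _ _ h4]
    exact Submodule.zero_mem _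

theorem dissect_four_theta_mul_pow_mem {c : ℤ⟦X⟧} (hc : theta (-X) * c = 1) (k : ℕ) (hk : 1 ≤ k) :
    dissect 4 (theta X * hauptmodul c ^ k) ∈
      (thetaSpan (hauptmodul c)).map (LinearMap.mulLeft ℤ 8) := by
  have h1 : theta X * hauptmodul c ^ k = expand 4 (by norm_num) (c ^ (16 * k)) *
      ((thetaEven + thetaOdd) ^ (4 * k + 1) * (thetaEven ^ 2 + thetaOdd ^ 2) ^ (5 * k) *
        (thetaEven * thetaOdd) ^ k) := by
    have hi := inv_theta_neg_eq hc
    have hh : hauptmodul c = ((thetaEven + thetaOdd) * (thetaEven ^ 2 + thetaOdd ^ 2) *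
        expand 4 (by norm_num) (c ^ 4)) ^ 4 * (thetaEven * thetaOdd *
          (thetaEven ^ 2 + thetaOdd ^ 2)) := by
      rw [← hi, hauptmodul]
    rw [hh, theta_X_eq, show c ^ (16 * k) = (c ^ 4) ^ (4 * k) by ring,
      map_pow (expand 4 _) (c ^ 4)]
    generalize expand 4 _ (c ^ 4) = e
    generalize thetaEven + thetaOdd = u
    generalize thetaEven ^ 2 + thetaOdd ^ 2 = v
    ring
  rw [h1, add_pow, add_pow, Finset.sum_mul_sum, Finset.sum_mul, Finset.mul_sum, map_sum]
  refine Submodule.sum_mem _ fun a ha => ?_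
  rw [Finset.sum_mul, Finset.mul_sum, map_sum]
  refine Submodule.sum_mem _ fun b hb => ?_
  have ha' : a < 4 * k + 1 + 1 := Finset.mem_range.mp ha
  have hb' : b < 5 * k + 1 := Finset.mem_range.mp hb
  -- These are the exponents of A and B in the (a, b) term of the binomial expansions. The last `+
  -- k`, from (AB)^k, ensures l ≥ 1.
  have h := dissect_four_monomial_mem hc k (a + 2 * b + k)
    ((4 * k + 1 - a) + 2 * (5 * k - b) + k) (by omega) (by omega)
  have h' := Submodule.smul_mem _ (((4 * k + 1).choose a * (5 * k).choose b : ℕ) : ℤ) h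
  rw [← map_smul] at h'
  convert h' using 2
  rw [zsmul_eq_mul]
  push_cast
  ring

theorem exists_dissect_four_eq {c : ℤ⟦X⟧} (hc : theta (-X) * c = 1) {f : ℤ⟦X⟧}
    (hf : f ∈ thetaSpan (hauptmodul c)) :
    ∃ g ∈ thetaSpan (hauptmodul c), dissect 4 f = 8 * g := by
  have h : thetaSpan (hauptmodul c) ≤
      ((thetaSpan (hauptmodul c)).map (LinearMap.mulLeft ℤ 8)).comap (dissect 4) := by
    refine Submodule.span_le.mpr ?_
    rintro _ ⟨k, rfl⟩
    exact dissect_four_theta_mul_pow_mem hc (k + 1) (by omega)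
  obtain ⟨g, hg, h'⟩ := h hf
  exact ⟨g, hg, h'.symm⟩

theorem two_dvd_of_mem_thetaSpan {c f : ℤ⟦X⟧} (hf : f ∈ thetaSpan (hauptmodul c)) : 2 ∣ f := by
  induction hf using Submodule.span_induction with
  | mem x hx =>
    obtain ⟨k, rfl⟩ := hx
    exact (dvd_pow (two_dvd_hauptmodul c) (by omega)).mul_left _
  | zero => exact dvd_zero _
  | add x y _ _ hx hy => exact dvd_add hx hy
  | smul a x _ hx =>
    rw [zsmul_eq_mul]
    exact hx.mul_left _

theorem exists_iterate_dissect_eq {c : ℤ⟦X⟧} (hc : theta (-X) * c = 1) (α : ℕ) :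
    ∃ g ∈ thetaSpan (hauptmodul c), (dissect 4)^[α + 1] (theta X ^ 2 * c) =
      theta X + 2 ^ (3 * α + 5) * g := by
  induction α with
  | zero =>
    refine ⟨theta X * hauptmodul c, Submodule.subset_span ⟨0, by simp⟩, ?_⟩
    rw [zero_add, Function.iterate_one, dissect_four_theta_sq_mul hc]
    norm_num
  | succ α ih =>
    obtain ⟨f, hf, h⟩ := ih
    obtain ⟨g, hg, h'⟩ := exists_dissect_four_eq hc hf
    refine ⟨g, hg, ?_⟩
    have h2 : (2 : ℤ⟦X⟧) ^ (3 * α + 5) * f = ((2 : ℤ) ^ (3 * α + 5)) • f := by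
      rw [zsmul_eq_mul]
      push_cast
      rfl
    rw [Function.iterate_succ_apply', h, map_add, dissect_four_theta, h2, map_smul, h',
      zsmul_eq_mul]
    push_cast
    ring

theorem coeff_iterate_dissect (p k n : ℕ) (f : ℤ⟦X⟧) :
    coeff n ((dissect p)^[k] f) = coeff (p ^ k * n) f := by
  induction k generalizing n with
  | zero => simp
  | succ k ih => rw [Function.iterate_succ_apply', coeff_dissect, ih, pow_succ, mul_assoc]

/-! ### Euler's series -/

theorem X_pow_dvd_tsum {ι : Type*} {f : ι → ℤ⟦X⟧} {d : ℕ} (h : ∀ i, (X : ℤ⟦X⟧) ^ d ∣ f i) :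
    X ^ d ∣ ∑' i, f i := by
  by_cases hf : Summable f
  · rw [X_pow_dvd_iff]
    intro m hm
    have h1 := (PowerSeries.WithPiTopology.hasSum_iff_hasSum_coeff (R := ℤ)).mp hf.hasSum m
    refine h1.unique ?_
    convert hasSum_zero with i
    exact X_pow_dvd_iff.mp (h i) m hm
  · rw [tsum_eq_zero_of_not_summable hf]
    exact dvd_zero _

theorem eq_zero_of_forall_X_pow_dvd {f : ℤ⟦X⟧} (h : ∀ d, X ^ d ∣ f) : f = 0 := by
  ext d
  exact X_pow_dvd_iff.mp (h (d + 1)) d (Nat.lt_succ_self d)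

theorem constantCoeff_qPoch {a Q : ℤ⟦X⟧} (ha : X ∣ a) (n : ℕ) :
    constantCoeff (qPoch a Q n) = 1 := by
  have h : constantCoeff a = 0 := X_dvd_iff.mp ha
  simp [qPoch, map_prod, h]

theorem qPoch_ne_zero {a Q : ℤ⟦X⟧} (ha : X ∣ a) (n : ℕ) : qPoch a Q n ≠ 0 := by
  intro h
  have := constantCoeff_qPoch (Q := Q) ha n
  rw [h, map_zero] at this
  exact zero_ne_one this

theorem qPoch_zero (a Q : ℤ⟦X⟧) : qPoch a Q 0 = 1 := by simp [qPoch]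

theorem qPoch_succ (a Q : ℤ⟦X⟧) (n : ℕ) : qPoch a Q (n + 1) = qPoch a Q n * (1 - a * Q ^ n) :=
  Finset.prod_range_succ _ _

/-- `1 / (P; P)_k`. -/
noncomputable def invPoch (P : ℤ⟦X⟧) (k : ℕ) : ℤ⟦X⟧ := invOfUnit (qPoch P P k) 1

theorem qPoch_mul_invPoch {P : ℤ⟦X⟧} (hP : X ∣ P) (k : ℕ) : qPoch P P k * invPoch P k = 1 :=
  mul_invOfUnit _ _ (by rw [constantCoeff_qPoch hP, Units.val_one])

theorem invPoch_zero {P : ℤ⟦X⟧} (hP : X ∣ P) : invPoch P 0 = 1 := by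
  have h := qPoch_mul_invPoch hP 0
  rwa [qPoch_zero, one_mul] at h

/-- The recursion through which every later fact about `invPoch` is obtained. -/
theorem one_sub_pow_mul_invPoch {P : ℤ⟦X⟧} (hP : X ∣ P) (k : ℕ) :
    (1 - P ^ (k + 1)) * invPoch P (k + 1) = invPoch P k := by
  have h1 := qPoch_mul_invPoch hP k
  have h2 := qPoch_mul_invPoch hP (k + 1)
  rw [qPoch_succ] at h2
  apply mul_left_cancel₀ (qPoch_ne_zero (Q := P) hP k)
  rw [h1, pow_succ']
  linear_combination h2

theorem one_sub_pow_ne_zero {P : ℤ⟦X⟧} (hP : X ∣ P) {k : ℕ} (hk : k ≠ 0) : 1 - P ^ k ≠ 0 := by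
  intro h
  have h1 : constantCoeff P = 0 := X_dvd_iff.mp hP
  have h2 := congrArg constantCoeff h
  simp [h1, hk] at h2

/-- The alternating convolution of `1 / (P; P)_k` with itself. -/
noncomputable def altConv (P : ℤ⟦X⟧) (m : ℕ) : ℤ⟦X⟧ :=
  ∑ p ∈ Finset.HasAntidiagonal.antidiagonal m, (-1) ^ p.2 * (invPoch P p.1 * invPoch P p.2)

/-- For j + k = m + 2, 1 - P^(j+k) = (1 - P^j) + (1 - P^k) - (1 - P^j)(1 - P^k). The first two
pieces cancel by the alternating sign; the last lowers both indices. -/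
theorem one_sub_pow_mul_altConv {P : ℤ⟦X⟧} (hP : X ∣ P) (m : ℕ) :
    (1 - P ^ (m + 2)) * altConv P (m + 2) = altConv P m := by
  have h1 : ∑ p ∈ Finset.HasAntidiagonal.antidiagonal (m + 1 + 1),
      (-1) ^ p.2 * (((1 - P ^ p.1) * invPoch P p.1) * invPoch P p.2) = altConv P (m + 1) := by
    rw [Finset.Nat.sum_antidiagonal_succ]
    simp only [pow_zero, sub_self, zero_mul, mul_zero, zero_add, one_sub_pow_mul_invPoch hP]
    rfl
  have h2 : ∑ p ∈ Finset.HasAntidiagonal.antidiagonal (m + 1 + 1),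
      (-1) ^ p.2 * (invPoch P p.1 * ((1 - P ^ p.2) * invPoch P p.2)) = -altConv P (m + 1) := by
    rw [Finset.Nat.sum_antidiagonal_succ']
    simp only [pow_zero, sub_self, zero_mul, mul_zero, zero_add,
      one_sub_pow_mul_invPoch hP]
    rw [altConv, ← Finset.sum_neg_distrib]
    refine Finset.sum_congr rfl fun p _ => ?_
    ring
  have h3 : ∑ p ∈ Finset.HasAntidiagonal.antidiagonal (m + 1 + 1), (-1) ^ p.2 *
      (((1 - P ^ p.1) * invPoch P p.1) * ((1 - P ^ p.2) * invPoch P p.2)) = -altConv P m := by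
    rw [Finset.Nat.sum_antidiagonal_succ, Finset.Nat.sum_antidiagonal_succ']
    simp only [pow_zero, sub_self, zero_mul, mul_zero, zero_add,
      one_sub_pow_mul_invPoch hP]
    rw [altConv, ← Finset.sum_neg_distrib]
    refine Finset.sum_congr rfl fun p _ => ?_
    ring
  have h4 : (1 - P ^ (m + 2)) * altConv P (m + 2) = altConv P (m + 1) + -altConv P (m + 1)
      - -altConv P m := by
    rw [← h2, ← h3, ← h1, altConv, Finset.mul_sum, ← Finset.sum_add_distrib,
      ← Finset.sum_sub_distrib]
    refine Finset.sum_congr rfl fun p hp => ?_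
    have hp' : p.1 + p.2 = m + 2 := Finset.HasAntidiagonal.mem_antidiagonal.mp hp
    rw [← hp', pow_add]
    ring
  rw [h4]
  ring

theorem altConv_odd {P : ℤ⟦X⟧} (hP : X ∣ P) (h : ℕ) : altConv P (2 * h + 1) = 0 := by
  induction h with
  | zero => simp [altConv, Finset.Nat.antidiagonal_succ, mul_comm]
  | succ h ih =>
    have h1 := one_sub_pow_mul_altConv hP (2 * h + 1)
    rw [ih, mul_eq_zero] at h1
    exact h1.resolve_left (one_sub_pow_ne_zero hP (by omega))

theorem altConv_even {P : ℤ⟦X⟧} (hP : X ∣ P) (h : ℕ) : altConv P (2 * h) = invPoch (P ^ 2) h := by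
  have hP2 : X ∣ P ^ 2 := dvd_pow hP two_ne_zero
  induction h with
  | zero => simp [altConv, invPoch_zero hP, invPoch_zero hP2]
  | succ h ih =>
    have h1 := one_sub_pow_mul_altConv hP (2 * h)
    rw [ih, ← one_sub_pow_mul_invPoch hP2 h, ← pow_mul] at h1
    exact mul_left_cancel₀ (one_sub_pow_ne_zero hP (by omega)) h1

/-- `∑ s ^ k Q ^ ((n + k) ^ 2) / (Q ^ 2; Q ^ 2)_k`, which for `n ≥ 0` is
`Q ^ (n ^ 2) (-s Q ^ (2 n + 1); Q ^ 2)_∞`. -/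
noncomputable def eulerSum (s Q : ℤ⟦X⟧) (n : ℤ) : ℤ⟦X⟧ :=
  ∑' k : ℕ, s ^ k * qpow Q ((n + k) ^ 2) * invPoch (Q ^ 2) k

theorem X_pow_dvd_eulerSum_term (s : ℤ⟦X⟧) {Q : ℤ⟦X⟧} (hQ : X ∣ Q) (n : ℤ) (k : ℕ) :
    X ^ ((n + k) ^ 2).toNat ∣ s ^ k * qpow Q ((n + k) ^ 2) * invPoch (Q ^ 2) k :=
  ((X_pow_dvd_qpow hQ _).mul_left _).mul_right _

theorem finite_setOf_shift_sq_le (n : ℤ) (d : ℕ) : {k : ℕ | ((n + k) ^ 2).toNat ≤ d}.Finite :=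
  (finite_setOf_sq_le d).preimage (f := fun k : ℕ => n + (k : ℤ))
    (fun a _ b _ h => by simpa using h)

theorem summable_eulerSum (s : ℤ⟦X⟧) {Q : ℤ⟦X⟧} (hQ : X ∣ Q) (n : ℤ) :
    Summable fun k : ℕ => s ^ k * qpow Q ((n + k) ^ 2) * invPoch (Q ^ 2) k :=
  summable_of_X_pow_dvd _ (X_pow_dvd_eulerSum_term s hQ n) (finite_setOf_shift_sq_le n)

/-- Each summand is split by 1 = Q^(2k) + (1 - Q^(2k)); the second factor lowers the index of
`invPoch`. For n ≥ 0 the first part is a multiple of the sum at n + 1, for n < 0 again of the sum at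
n + 1, since the square absorbs Q^(2k) in either case. -/
theorem eulerSum_eq (s : ℤ⟦X⟧) {Q : ℤ⟦X⟧} (hQ : X ∣ Q) (n : ℤ) :
    eulerSum s Q n = ∑' k : ℕ, s ^ k * qpow Q ((n + k) ^ 2) * invPoch (Q ^ 2) k * Q ^ (2 * k)
      + s * eulerSum s Q (n + 1) := by
  have hQ2 : X ∣ Q ^ 2 := dvd_pow hQ two_ne_zero
  have h0 := summable_eulerSum s hQ n
  have h1 : Summable fun k : ℕ =>
      s ^ k * qpow Q ((n + k) ^ 2) * invPoch (Q ^ 2) k * Q ^ (2 * k) :=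
    summable_of_X_pow_dvd _ (fun k => (X_pow_dvd_eulerSum_term s hQ n k).mul_right _)
      (finite_setOf_shift_sq_le n)
  rw [← sub_eq_iff_eq_add', eulerSum, ← h0.tsum_sub h1, (h0.sub h1).tsum_eq_zero_add, eulerSum,
    ← (summable_eulerSum s hQ (n + 1)).tsum_mul_left]
  simp only [mul_zero, pow_zero, mul_one, sub_self, zero_add]
  refine tsum_congr fun k => ?_
  rw [← one_sub_pow_mul_invPoch hQ2 k,
    show n + ((k + 1 : ℕ) : ℤ) = n + 1 + k by push_cast; ring, ← pow_mul]
  ring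

theorem eulerSum_succ_nat {s Q : ℤ⟦X⟧} (hQ : X ∣ Q) (m : ℕ) :
    eulerSum s Q (m + 1 : ℕ) * (1 + s * Q ^ (2 * m + 1)) = Q ^ (2 * m + 1) * eulerSum s Q m := by
  have h : Q ^ (2 * m + 1) *
      ∑' k : ℕ, s ^ k * qpow Q ((m + k) ^ 2) * invPoch (Q ^ 2) k * Q ^ (2 * k) =
      eulerSum s Q (m + 1) := by
    rw [eulerSum, ← Summable.tsum_mul_left]
    · refine tsum_congr fun k => ?_
      have h1 : qpow Q (2 * m + 1 : ℕ) * (qpow Q ((m + k) ^ 2) * qpow Q (2 * k : ℕ))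
          = qpow Q ((m + 1 + k) ^ 2) := by
        rw [qpow_mul_qpow _ (by positivity) (by positivity),
          qpow_mul_qpow _ (by positivity) (by positivity)]
        congr 1
        push_cast
        ring
      rw [qpow_natCast, qpow_natCast] at h1
      rw [← h1]
      ring
    · exact summable_of_X_pow_dvd _ (fun k => (X_pow_dvd_eulerSum_term s hQ m k).mul_right _)
        (finite_setOf_shift_sq_le m)
  rw [eulerSum_eq s hQ m, mul_add (Q ^ (2 * m + 1)), h]
  push_cast
  ring

theorem eulerSum_neg_succ {s Q : ℤ⟦X⟧} (hQ : X ∣ Q) (m : ℕ) :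
    eulerSum s Q (-((m + 1 : ℕ) : ℤ)) = (s + Q ^ (2 * m + 1)) * eulerSum s Q (-(m : ℤ)) := by
  have h : ∑' k : ℕ, s ^ k * qpow Q ((-((m + 1 : ℕ) : ℤ) + k) ^ 2) * invPoch (Q ^ 2) k *
      Q ^ (2 * k) = Q ^ (2 * m + 1) * eulerSum s Q (-(m : ℤ)) := by
    rw [eulerSum, ← (summable_eulerSum s hQ _).tsum_mul_left]
    refine tsum_congr fun k => ?_
    have h1 : qpow Q ((-((m + 1 : ℕ) : ℤ) + k) ^ 2) * qpow Q (2 * k : ℕ) =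
        qpow Q (2 * m + 1 : ℕ) * qpow Q ((-(m : ℤ) + k) ^ 2) := by
      rw [qpow_mul_qpow _ (by positivity) (by positivity),
        qpow_mul_qpow _ (by positivity) (by positivity)]
      congr 1
      push_cast
      ring
    rw [qpow_natCast, qpow_natCast] at h1
    linear_combination (s ^ k * invPoch (Q ^ 2) k) * h1
  rw [eulerSum_eq s hQ, h, show -((m + 1 : ℕ) : ℤ) + 1 = -(m : ℤ) by push_cast; ring]
  ring

theorem eulerSum_nat {s Q : ℤ⟦X⟧} (hQ : X ∣ Q) (m : ℕ) :
    eulerSum s Q m * qPoch (-(s * Q)) (Q ^ 2) m = Q ^ (m ^ 2) * eulerSum s Q 0 := by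
  induction m with
  | zero => simp [qPoch_zero]
  | succ m ih =>
    have h := eulerSum_succ_nat (s := s) hQ m
    rw [qPoch_succ, show (m + 1) ^ 2 = 2 * m + 1 + m ^ 2 by ring, pow_add, mul_assoc, ← ih]
    linear_combination qPoch (-(s * Q)) (Q ^ 2) m * h

theorem eulerSum_neg_nat {s Q : ℤ⟦X⟧} (hs : s ^ 2 = 1) (hQ : X ∣ Q) (m : ℕ) :
    eulerSum s Q (-(m : ℤ)) = s ^ m * qPoch (-(s * Q)) (Q ^ 2) m * eulerSum s Q 0 := by
  induction m with
  | zero => simp [qPoch_zero]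
  | succ m ih =>
    rw [eulerSum_neg_succ hQ, ih, qPoch_succ]
    linear_combination
      (-Q ^ (2 * m + 1) * s ^ m * qPoch (-(s * Q)) (Q ^ 2) m * eulerSum s Q 0) * hs

/-- Euler's product formula in truncated form: the sum at `m` is Q^(m²) ε with ε ≡ 1 modulo X^m, and
`eulerSum_nat` relates ε to the sum at 0. -/
theorem X_pow_dvd_eulerSum_sub {s Q : ℤ⟦X⟧} (hQ : X ∣ Q) (hQ0 : Q ≠ 0) (m : ℕ) :
    X ^ m ∣ eulerSum s Q 0 - qPoch (-(s * Q)) (Q ^ 2) m := by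
  have hQ2 : X ∣ Q ^ 2 := dvd_pow hQ two_ne_zero
  set ε : ℤ⟦X⟧ := ∑' k : ℕ, s ^ k * qpow Q (2 * m * k + k ^ 2) * invPoch (Q ^ 2) k with hε
  have hd : ∀ k : ℕ, X ^ (2 * m * k + k ^ 2) ∣
      s ^ k * qpow Q (2 * m * k + k ^ 2) * invPoch (Q ^ 2) k := fun k => by
    have := X_pow_dvd_qpow hQ ((2 * m * k + k ^ 2 : ℕ) : ℤ)
    rw [Int.toNat_natCast] at this
    push_cast at this
    exact (this.mul_left _).mul_right _
  have hsum : Summable fun k : ℕ => s ^ k * qpow Q (2 * m * k + k ^ 2) * invPoch (Q ^ 2) k := by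
    refine summable_of_X_pow_dvd _ hd fun d => (Set.finite_Iic d).subset fun k hk => ?_
    have hk' : 2 * m * k + k ^ 2 ≤ d := hk
    exact (by nlinarith [Nat.le_self_pow two_ne_zero k] : k ≤ d)
  have h1 : eulerSum s Q m = Q ^ (m ^ 2) * ε := by
    rw [hε, ← hsum.tsum_mul_left, eulerSum]
    refine tsum_congr fun k => ?_
    have h2 : Q ^ (m ^ 2) * qpow Q (2 * m * k + k ^ 2) = qpow Q ((m + k) ^ 2) := by
      rw [← qpow_natCast, qpow_mul_qpow _ (by positivity) (by positivity)]
      congr 1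
      push_cast
      ring
    rw [← h2]
    ring
  have h3 : ε * qPoch (-(s * Q)) (Q ^ 2) m = eulerSum s Q 0 := by
    have h := eulerSum_nat (s := s) hQ m
    rw [h1, mul_assoc] at h
    exact mul_left_cancel₀ (pow_ne_zero _ hQ0) h
  have h4 : X ^ m ∣ ε - 1 := by
    rw [hε, hsum.tsum_eq_zero_add]
    simp only [pow_zero, Nat.cast_zero, mul_zero, invPoch_zero hQ2, mul_one]
    rw [show (0 : ℤ) + 0 ^ 2 = 0 by norm_num, qpow_zero, one_mul, add_sub_cancel_left]
    refine X_pow_dvd_tsum fun k => (pow_dvd_pow X ?_).trans (hd (k + 1))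
    nlinarith [Nat.zero_le (m * k), Nat.zero_le m]
  rw [← h3, ← sub_one_mul]
  exact h4.mul_right _

/-- The integers k and k² have the same parity. -/
theorem eulerSum_neg_one {Q : ℤ⟦X⟧} : eulerSum (-1) Q 0 = eulerSum 1 (-Q) 0 := by
  refine tsum_congr fun k => ?_
  rw [neg_sq, one_pow, one_mul, neg_eq_neg_one_mul Q, qpow_mul_base, zero_add]
  congr 2
  rw [qpow, show ((k : ℤ) ^ 2).toNat = k ^ 2 by norm_cast]
  rcases Nat.even_or_odd k with h | h
  · rw [h.neg_one_pow, (h.pow_of_ne_zero two_ne_zero).neg_one_pow]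
  · rw [h.neg_one_pow, h.pow.neg_one_pow]

/-- Factor by factor, (1 + Q^(2i+1))(1 - Q^(2i+1)) = 1 - Q^(4i+2). -/
theorem eulerSum_mul_eulerSum_neg {Q : ℤ⟦X⟧} (hQ : X ∣ Q) (hQ0 : Q ≠ 0) :
    eulerSum 1 Q 0 * eulerSum 1 (-Q) 0 = eulerSum 1 (-Q ^ 2) 0 := by
  refine sub_eq_zero.mp (eq_zero_of_forall_X_pow_dvd fun m => ?_)
  have h1 := X_pow_dvd_eulerSum_sub (s := 1) hQ hQ0 m
  have h2 := X_pow_dvd_eulerSum_sub (s := 1) (dvd_neg.mpr hQ) (neg_ne_zero.mpr hQ0) m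
  have h3 := X_pow_dvd_eulerSum_sub (s := 1) (Q := -Q ^ 2)
    (dvd_neg.mpr (dvd_pow hQ two_ne_zero)) (neg_ne_zero.mpr (pow_ne_zero _ hQ0)) m
  have h4 : qPoch (-(1 * Q)) (Q ^ 2) m * qPoch (-(1 * -Q)) ((-Q) ^ 2) m
      = qPoch (-(1 * -Q ^ 2)) ((-Q ^ 2) ^ 2) m := by
    rw [qPoch, qPoch, qPoch, ← Finset.prod_mul_distrib]
    refine Finset.prod_congr rfl fun i _ => ?_
    rw [neg_sq, neg_sq]
    ring
  have h5 := (((h1.mul_right (eulerSum 1 (-Q) 0)).add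
    (h2.mul_left (qPoch (-(1 * Q)) (Q ^ 2) m))).sub h3)
  convert h5 using 1
  rw [← h4]
  ring

/-! ### The bilateral sums -/

theorem tsum_prod_eq_tsum_sum_antidiagonal {f : ℕ × ℕ → ℤ⟦X⟧} (hf : Summable f) :
    ∑' p, f p = ∑' m, ∑ p ∈ Finset.HasAntidiagonal.antidiagonal m, f p := by
  conv_rhs =>
    congr
    ext
    rw [← Finset.sum_finset_coe, ← tsum_fintype (L := .unconditional _)]
  rw [← Finset.HasAntidiagonal.sigmaAntidiagonalEquivProd.tsum_eq f]
  exact (Finset.HasAntidiagonal.sigmaAntidiagonalEquivProd.summable_iff.mpr hf).tsum_sigma'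
    (fun n => (hasSum_fintype _).summable)

theorem qpow_eq_qpow_of_sq_eq_one {z : ℤ⟦X⟧} (hz : z ^ 2 = 1) {a b c : ℤ} (ha : 0 ≤ a) (hb : 0 ≤ b)
    (h : a - b = 2 * c) : qpow z a = qpow z b := by
  rcases le_or_gt 0 c with hc | hc
  · rw [show a = b + 2 * c by omega, ← qpow_mul_qpow _ hb (by omega),
      qpow_two_mul_of_sq_eq_one hz, mul_one]
  · rw [show b = a + 2 * (-c) by omega, ← qpow_mul_qpow _ ha (by omega),
      qpow_two_mul_of_sq_eq_one hz, mul_one]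

theorem finite_setOf_triple_le (d : ℕ) :
    {p : ℤ × ℕ × ℕ | ((-p.1 + p.2.1) ^ 2).toNat + ((p.1 + p.2.2) ^ 2).toNat ≤ d}.Finite := by
  apply ((Set.finite_Icc (-(d : ℤ)) d).prod
    ((Set.finite_Iic (2 * d)).prod (Set.finite_Iic (2 * d)))).subset
  rintro ⟨n, j, k⟩ h
  have h' : ((-n + j) ^ 2).toNat + ((n + k) ^ 2).toNat ≤ d := h
  have h1 : (-n + (j : ℤ)) ^ 2 ≤ d := by omega
  have h2 : (n + (k : ℤ)) ^ 2 ≤ d := by omega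
  have h3 : -n + (j : ℤ) ≤ d := by nlinarith
  have h4 : n + (k : ℤ) ≤ d := by nlinarith
  refine ⟨⟨?_, ?_⟩, ?_, ?_⟩ <;> simp only [Set.mem_Iic] <;> omega

/-- The inner sum over `n` in the bilateral sum. -/
noncomputable def thetaShift (z Q : ℤ⟦X⟧) (m : ℕ) : ℤ⟦X⟧ :=
  ∑' n : ℤ, qpow z (n ^ 2) * qpow Q (n ^ 2 + (n + m) ^ 2)

/-- Completing the square: (n - h)² + (n + h)² = 2n² + 2h². -/
theorem thetaShift_even {z Q : ℤ⟦X⟧} (hz : z ^ 2 = 1) (hQ : X ∣ Q) (h : ℕ) :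
    thetaShift z Q (2 * h) = theta (z * Q ^ 2) * qpow (z * Q ^ 2) (h ^ 2) := by
  have hQ2 : X ∣ z * Q ^ 2 := (dvd_pow hQ two_ne_zero).mul_left _
  rw [thetaShift, theta, ← (summable_theta hQ2).tsum_mul_right,
    ← (Equiv.subRight (h : ℤ)).tsum_eq]
  refine tsum_congr fun n => ?_
  rw [Equiv.subRight_apply, qpow_mul_qpow _ (by positivity) (by positivity), qpow_mul_base, qpow_pow,
    qpow_eq_qpow_of_sq_eq_one hz (b := n ^ 2 + h ^ 2) (c := -(n * h)) (by positivity)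
      (by positivity) (by ring)]
  congr 2
  push_cast
  ring

/-- Expanding both Euler series with indices j, k and shifting n by j leaves an exponent that
depends only on n and j + k. Summing over j + k = m produces `altConv`, which kills odd m; for even
m the theta series factors out. The case z = 1 gives the mock theta function and z = -1 a theta
identity. -/
theorem bilateral_sum {z Q : ℤ⟦X⟧} (hz : z ^ 2 = 1) (hQ : X ∣ Q) :
    HasSum (fun n : ℤ => qpow z (n ^ 2) * (eulerSum 1 Q (-n) * eulerSum (-z) Q n))
      (theta (z * Q ^ 2) * eulerSum 1 (z * Q ^ 2) 0) := by
  have hQ2 : X ∣ Q ^ 2 := dvd_pow hQ two_ne_zero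
  have hzQ2 : X ∣ z * Q ^ 2 := hQ2.mul_left _
  let F : ℤ → ℕ × ℕ → ℤ⟦X⟧ := fun n p => qpow z (n ^ 2) *
    ((1 ^ p.1 * qpow Q ((-n + p.1) ^ 2) * invPoch (Q ^ 2) p.1) *
      ((-z) ^ p.2 * qpow Q ((n + p.2) ^ 2) * invPoch (Q ^ 2) p.2))
  have hF : Summable (Function.uncurry F) := by
    refine summable_of_X_pow_dvd _ (fun p => ?_) finite_setOf_triple_le
    rw [pow_add]
    exact (mul_dvd_mul (X_pow_dvd_eulerSum_term 1 hQ (-p.1) p.2.1)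
      (X_pow_dvd_eulerSum_term (-z) hQ p.1 p.2.2)).mul_left _
  have hn : ∀ n : ℤ, HasSum (F n)
      (qpow z (n ^ 2) * (eulerSum 1 Q (-n) * eulerSum (-z) Q n)) := fun n =>
    (tsum_mul_tsum_of_X_pow_dvd _ _ (X_pow_dvd_eulerSum_term 1 hQ (-n))
      (X_pow_dvd_eulerSum_term (-z) hQ n) (finite_setOf_shift_sq_le (-n))
      (finite_setOf_shift_sq_le n)).mul_left _
  have hp : ∀ p : ℕ × ℕ, ∑' n, F n p = thetaShift z Q (p.1 + p.2) * z ^ (p.1 + p.2) *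
      ((-1) ^ p.2 * (invPoch (Q ^ 2) p.1 * invPoch (Q ^ 2) p.2)) := by
    rintro ⟨j, k⟩
    have hs : Summable fun n : ℤ =>
        qpow z (n ^ 2) * qpow Q (n ^ 2 + (n + ((j + k : ℕ) : ℤ)) ^ 2) := by
      refine summable_of_X_pow_dvd _ (fun n => (X_pow_dvd_qpow hQ _).mul_left _) fun d => ?_
      refine (finite_setOf_sq_le d).subset fun n h => ?_
      have h' : (n ^ 2 + (n + ((j + k : ℕ) : ℤ)) ^ 2).toNat ≤ d := h
      have h1 := sq_nonneg (n + ((j + k : ℕ) : ℤ))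
      exact (by omega : (n ^ 2).toNat ≤ d)
    rw [mul_assoc, thetaShift, ← hs.tsum_mul_right, ← (Equiv.addRight (j : ℤ)).tsum_eq]
    refine tsum_congr fun n => ?_
    have e1 : qpow z ((n + j) ^ 2) = qpow z (n ^ 2) * z ^ j := by
      rw [← qpow_natCast, qpow_mul_qpow _ (by positivity) (by positivity)]
      obtain ⟨c, hc⟩ := Int.even_mul_pred_self (j : ℤ)
      exact qpow_eq_qpow_of_sq_eq_one hz (c := n * j + c) (by positivity) (by positivity)
        (by linear_combination hc)
    have e2 : qpow Q ((-(n + j) + j) ^ 2) * qpow Q ((n + j + k) ^ 2) =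
        qpow Q (n ^ 2 + (n + ((j + k : ℕ) : ℤ)) ^ 2) := by
      rw [qpow_mul_qpow _ (by positivity) (by positivity)]
      congr 1
      push_cast
      ring
    simp only [F, Equiv.coe_addRight]
    rw [e1, ← e2, one_pow, neg_pow z, pow_add]
    ring
  have h1 : ∑' n : ℤ, qpow z (n ^ 2) * (eulerSum 1 Q (-n) * eulerSum (-z) Q n) =
      ∑' n, ∑' p, F n p := tsum_congr fun n => (hn n).tsum_eq.symm
  have h2 : ∑' n, ∑' p, F n p = ∑' m, thetaShift z Q m * z ^ m * altConv (Q ^ 2) m := by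
    have hG : Summable fun p => ∑' n, F n p := hF.prod_symm.prod
    rw [← hF.tsum_comm, tsum_prod_eq_tsum_sum_antidiagonal hG]
    refine tsum_congr fun m => ?_
    rw [altConv, Finset.mul_sum]
    refine Finset.sum_congr rfl fun p hpm => ?_
    rw [← Finset.HasAntidiagonal.mem_antidiagonal.mp hpm]
    exact hp p
  have h3 : ∑' m, thetaShift z Q m * z ^ m * altConv (Q ^ 2) m =
      theta (z * Q ^ 2) * eulerSum 1 (z * Q ^ 2) 0 := by
    have hi : Function.Injective fun h : ℕ => 2 * h := fun a b h => by simpa using h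
    rw [← hi.tsum_eq, eulerSum, ← (summable_eulerSum 1 hzQ2 0).tsum_mul_left]
    · refine tsum_congr fun h => ?_
      rw [altConv_even hQ2, thetaShift_even hz hQ, pow_mul z, hz, mul_pow z, hz, zero_add]
      simp only [one_pow, one_mul, mul_one]
      ring
    · intro m hm
      rcases Nat.even_or_odd' m with ⟨h, rfl | rfl⟩
      · exact ⟨h, rfl⟩
      · rw [Function.mem_support, altConv_odd hQ2, mul_zero] at hm
        exact absurd rfl hm
  rw [← h3, ← h2, ← h1]
  refine Summable.hasSum ?_
  exact hF.prod.congr fun n => (hn n).tsum_eq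

theorem eulerSum_ne_zero {Q : ℤ⟦X⟧} (hQ : X ∣ Q) (hQ0 : Q ≠ 0) : eulerSum 1 Q 0 ≠ 0 := by
  intro h
  have h1 := X_pow_dvd_eulerSum_sub (s := 1) hQ hQ0 1
  rw [h, zero_sub, dvd_neg, pow_one, X_dvd_iff,
    constantCoeff_qPoch (dvd_neg.mpr (hQ.mul_left _))] at h1
  exact one_ne_zero h1

/-- For z = -1 both Euler series have s = 1, so their Pochhammer factors cancel and the bilateral
sum collapses to a theta series. -/
theorem eulerSum_mul_theta_neg {Q : ℤ⟦X⟧} (hQ : X ∣ Q) (hQ0 : Q ≠ 0) :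
    eulerSum 1 Q 0 * theta (-Q) = theta (-Q ^ 2) * eulerSum 1 (-Q) 0 := by
  have h1 := (bilateral_sum (z := -1) (by norm_num) hQ).tsum_eq
  rw [neg_one_mul (Q ^ 2), ← eulerSum_mul_eulerSum_neg hQ hQ0, neg_neg] at h1
  have hnat : ∀ m : ℕ, eulerSum 1 Q (-(m : ℤ)) * eulerSum 1 Q m =
      Q ^ (m ^ 2) * eulerSum 1 Q 0 ^ 2 := fun m => by
    have h2 := eulerSum_nat (s := 1) hQ m
    rw [eulerSum_neg_nat (by norm_num) hQ, one_pow]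
    linear_combination eulerSum 1 Q 0 * h2
  have hterm : ∀ n : ℤ, qpow (-1) (n ^ 2) * (eulerSum 1 Q (-n) * eulerSum 1 Q n) =
      eulerSum 1 Q 0 ^ 2 * qpow (-Q) (n ^ 2) := fun n => by
    rw [neg_eq_neg_one_mul Q, qpow_mul_base]
    obtain ⟨m, rfl | rfl⟩ := Int.eq_nat_or_neg n
    · rw [hnat, show (m : ℤ) ^ 2 = ((m ^ 2 : ℕ) : ℤ) by push_cast; rfl, qpow_natCast Q]
      ring
    · rw [neg_neg, mul_comm (eulerSum 1 Q m), hnat, neg_sq,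
        show (m : ℤ) ^ 2 = ((m ^ 2 : ℕ) : ℤ) by push_cast; rfl, qpow_natCast Q]
      ring
  rw [tsum_congr hterm, (summable_theta (dvd_neg.mpr hQ)).tsum_mul_left] at h1
  change _ * theta (-Q) = _ at h1
  apply mul_left_cancel₀ (eulerSum_ne_zero hQ hQ0)
  linear_combination h1

/-! ### The even part of the mock theta function -/

theorem HasSum.evalNegHom {ι : Type*} {f : ι → ℤ⟦X⟧} {a : ℤ⟦X⟧} (h : HasSum f a) :
    HasSum (fun i => PowerSeries.evalNegHom (f i)) (PowerSeries.evalNegHom a) := by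
  rw [PowerSeries.WithPiTopology.hasSum_iff_hasSum_coeff] at h ⊢
  intro d
  simp only [PowerSeries.evalNegHom, coeff_rescale]
  exact (h d).mul_left _

theorem evalNegHom_qPoch (a Q : ℤ⟦X⟧) (n : ℕ) :
    evalNegHom (qPoch a Q n) = qPoch (evalNegHom a) (evalNegHom Q) n := by
  simp [qPoch, map_prod]

theorem v0Term_zero : v0Term 0 = 1 := by
  have h := v0Term_mul_denominator 0
  simpa [qPoch] using h

theorem bilateral_v0 :
    (PowerSeries.mk v0 + evalNegHom (PowerSeries.mk v0) - 1) * eulerSum 1 (-X ^ 2) 0 =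
      theta (X ^ 2) * eulerSum 1 (X ^ 2) 0 := by
  have hX : (X : ℤ⟦X⟧) ≠ 0 := X_ne_zero
  have h1 := bilateral_sum (z := 1) (Q := X) (by norm_num) dvd_rfl
  rw [one_mul] at h1
  rw [← eulerSum_mul_eulerSum_neg dvd_rfl hX]
  set e := eulerSum 1 X 0 * eulerSum 1 (-X) 0
  have hpos : ∀ n : ℕ, qpow 1 ((n : ℤ) ^ 2) * (eulerSum 1 X (-(n : ℤ)) * eulerSum (-1) X n) =
      v0Term n * e := fun n => by
    have h2 := eulerSum_nat (s := -1) (Q := X) dvd_rfl n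
    have h3 := v0Term_mul_denominator n
    rw [neg_one_mul, neg_neg, eulerSum_neg_one] at h2
    rw [eulerSum_neg_nat (by norm_num) dvd_rfl, one_mul, one_pow, one_mul, qpow, one_pow, one_mul]
    apply mul_right_cancel₀ (qPoch_ne_zero (a := X) (Q := X ^ 2) dvd_rfl n)
    linear_combination (qPoch (-X) (X ^ 2) n * eulerSum 1 X 0) * h2 - e * h3
  -- Reversing the sign of the index amounts to q ↦ -q in the summand.
  have hneg : ∀ n : ℕ, qpow 1 ((-(n : ℤ)) ^ 2) *
      (eulerSum 1 X (- -(n : ℤ)) * eulerSum (-1) X (-(n : ℤ))) =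
      evalNegHom (v0Term n) * e := fun n => by
    have h2 := eulerSum_nat (s := 1) (Q := X) dvd_rfl n
    have h3 := congrArg evalNegHom (v0Term_mul_denominator n)
    simp only [map_mul, map_pow, map_neg, evalNegHom_qPoch, evalNegHom_X, neg_neg, neg_sq] at h3
    have h4 : (-X : ℤ⟦X⟧) ^ n ^ 2 = (-1) ^ n * X ^ n ^ 2 := by
      rw [neg_pow]
      congr 1
      rcases Nat.even_or_odd n with h | h
      · rw [h.neg_one_pow, (h.pow_of_ne_zero two_ne_zero).neg_one_pow]
      · rw [h.neg_one_pow, h.pow.neg_one_pow]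
    rw [h4] at h3
    rw [one_mul] at h2
    rw [neg_neg, eulerSum_neg_nat (s := -1) (by norm_num) dvd_rfl, neg_one_mul, neg_neg,
      eulerSum_neg_one, qpow, one_pow, one_mul]
    apply mul_right_cancel₀ (qPoch_ne_zero (a := -X) (Q := X ^ 2) (dvd_neg.mpr dvd_rfl) n)
    linear_combination ((-1) ^ n * qPoch X (X ^ 2) n * eulerSum 1 (-X) 0) * h2 - e * h3
  have hs1 : HasSum (fun n : ℕ => v0Term n * e) (PowerSeries.mk v0 * e) :=
    hasSum_v0Term.mul_right e
  -- The index 0 already occurs among the nonnegative ones, hence the -1.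
  have hs2 : HasSum (fun n : ℕ => evalNegHom (v0Term (n + 1)) * e)
      ((evalNegHom (PowerSeries.mk v0) - 1) * e) := by
    refine HasSum.mul_right e ?_
    have h2 := hasSum_v0Term.evalNegHom
    rw [← hasSum_nat_add_iff' 1] at h2
    simpa [v0Term_zero] using h2
  have hs3 := HasSum.of_nat_of_neg_add_one
    (f := fun n : ℤ => qpow 1 (n ^ 2) * (eulerSum 1 X (-n) * eulerSum (-1) X n))
    (by simpa only [hpos] using hs1)
    (by simpa only [← Nat.cast_add_one, hneg] using hs2)
  rw [h1.unique hs3]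
  ring

theorem v0_even_part_mul_theta :
    (PowerSeries.mk v0 + evalNegHom (PowerSeries.mk v0) - 1) * theta (-X ^ 4) =
      theta (X ^ 2) ^ 2 := by
  have hX2 : (X : ℤ⟦X⟧) ∣ X ^ 2 := dvd_pow_self _ two_ne_zero
  have hX0 : (X : ℤ⟦X⟧) ^ 2 ≠ 0 := pow_ne_zero _ X_ne_zero
  have h1 := bilateral_v0
  have h2 := eulerSum_mul_theta_neg (dvd_neg.mpr hX2) (neg_ne_zero.mpr hX0)
  rw [neg_neg, neg_sq, ← pow_mul] at h2
  norm_num at h2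
  apply mul_right_cancel₀ (eulerSum_ne_zero hX2 hX0)
  linear_combination theta (X ^ 2) * h1 -
    (PowerSeries.mk v0 + evalNegHom (PowerSeries.mk v0) - 1) * h2

theorem theta_X_sq_sq : theta (X ^ 2) ^ 2 = expand 4 (by norm_num) (theta X ^ 2) +
    expand 4 (by norm_num) (2 * theta (X ^ 2) * thetaTri (X ^ 2)) * X ^ 2 := by
  have hX2 : (X : ℤ⟦X⟧) ∣ X ^ 2 := dvd_pow_self _ two_ne_zero
  have h1 := theta_eq_add hX2
  have h2 := theta_sq_add hX2 (P := 1) (by norm_num)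
  rw [one_mul, one_mul, ← pow_mul, ← pow_mul] at h2
  rw [← pow_mul] at h1
  rw [map_pow, map_mul, map_mul, map_ofNat, expand_theta _ _ dvd_rfl, expand_theta _ _ hX2,
    expand_thetaTri _ _ hX2, map_pow, expand_X, ← pow_mul, h1, ← h2]
  ring

theorem dissect_four_v0 {c : ℤ⟦X⟧} (hc : theta (-X) * c = 1) :
    dissect 4 (PowerSeries.mk v0 + evalNegHom (PowerSeries.mk v0) - 1) = theta X ^ 2 * c := by
  have h1 := v0_even_part_mul_theta
  have h2 : theta (-X ^ 4) * expand 4 (by norm_num) c = 1 := by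
    rw [← map_one (expand 4 (by norm_num)), ← hc, map_mul, expand_theta _ _ (dvd_neg.mpr dvd_rfl),
      map_neg, expand_X]
  have h3 : PowerSeries.mk v0 + evalNegHom (PowerSeries.mk v0) - 1 =
      expand 4 (by norm_num) (theta X ^ 2 * c) +
        expand 4 (by norm_num) (2 * theta (X ^ 2) * thetaTri (X ^ 2) * c) * X ^ 2 := by
    have h4 := theta_X_sq_sq
    rw [map_mul _ (theta X ^ 2) c, map_mul _ _ c]
    linear_combination (expand 4 (by norm_num) c) * (h1 + h4) -
      (PowerSeries.mk v0 + evalNegHom (PowerSeries.mk v0) - 1) * h2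
  rw [h3, map_add, dissect_expand, dissect_expand_mul_X_pow_of_not_dvd _ _ _ (by norm_num),
    add_zero]

theorem coeff_dissect_four_v0 {m : ℕ} (hm : m ≠ 0) :
    coeff m (dissect 4 (PowerSeries.mk v0 + evalNegHom (PowerSeries.mk v0) - 1)) =
      2 * v0 (4 * m) := by
  have h : Even (4 * m) := ⟨2 * m, by ring⟩
  rw [coeff_dissect, map_sub, map_add, coeff_one, if_neg (by omega), PowerSeries.evalNegHom,
    coeff_rescale, coeff_mk, h.neg_one_pow]
  ring

/-! ### The congruence at nonsquare indices -/

theorem two_pow_dvd_v0 {m : ℕ} (hm : ¬ IsSquare m) (α : ℕ) :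
    (2 : ℤ) ^ (3 * α + 5) ∣ v0 (2 ^ (2 * α + 4) * m) := by
  obtain ⟨c, hc⟩ := exists_theta_neg_mul_eq_one
  obtain ⟨f, hf, h⟩ := exists_iterate_dissect_eq hc α
  obtain ⟨g, rfl⟩ := two_dvd_of_mem_thetaSpan hf
  have hm0 : m ≠ 0 := by
    rintro rfl
    exact hm ⟨0, rfl⟩
  have h1 := congrArg (coeff m) h
  rw [coeff_iterate_dissect, ← dissect_four_v0 hc, coeff_dissect_four_v0 (by positivity), map_add,
    coeff_theta_X_of_not_isSquare hm, zero_add,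
    show (2 : ℤ⟦X⟧) ^ (3 * α + 5) * (2 * g) = C (2 ^ (3 * α + 5) * 2 : ℤ) * g by
      rw [map_mul, map_pow, map_ofNat]; ring, coeff_C_mul] at h1
  refine ⟨coeff m g, ?_⟩
  rw [show 2 ^ (2 * α + 4) * m = 4 * (4 ^ (α + 1) * m) by
    rw [show (4 : ℕ) = 2 ^ 2 by norm_num, ← pow_mul]; ring]
  linarith

theorem mainTheorem6 (α : ℕ) (hα : 1 ≤ α) (p : ℕ) (hp : p.Prime) (hp3 : 3 ≤ p)
    (r : ℕ) (hr : ¬ IsSquare (r : ZMod p)) (n : ℕ) :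
    v0 (2 ^ (2 * α + 2) * (p * n + r)) ≡ 0 [ZMOD 2 ^ (3 * α + 2)] := by
  -- With α = β + 1 the exponents 2α + 2 and 3α + 2 become 2β + 4 and 3β + 5.
  obtain ⟨β, rfl⟩ : ∃ β, α = β + 1 := ⟨α - 1, by omega⟩
  have hm : ¬ IsSquare (p * n + r) := by
    rintro ⟨a, ha⟩
    refine hr ⟨(a : ZMod p), ?_⟩
    have h := congrArg (Nat.cast : ℕ → ZMod p) ha
    simpa using h
  exact Int.modEq_zero_iff_dvd.mpr (two_pow_dvd_v0 hm β)
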